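/- Let $\mathbb K$ be $\mathbb R$ or $\mathbb C$; all Banach spaces, linear maps and duals are over $\mathbb K$. A Banach space $X$ is called \emph{L-embedded} if there is a bounded linear projection $P$ on its bidual $X^{**}$ whose range is $X$ (canonically embedded in $X^{**}$) such that $\|x^{**}\|=\|Px^{**}\|+\|x^{**}-Px^{**}\|$ for all $x^{**}\in X^{**}$. A Banach space $Y$ is called \emph{the unique isometric predual of its dual} if $Y$ is linearly isometric (by a surjective linear isometry) to every Banach space $Z$ whose dual $Z^*$ is linearly isometric (by a surjective linear isometry) to $Y^*$. \textbf{Corollary.} Let $X$ be a separable L-embedded Banach space. Then every Banach space $Y$ which is isomorphic (by a linear homeomorphism) to a subspace of $X$ is the unique isometric predual of its dual. In particular, $X$ itself is the unique isometric predual of its dual. -/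

import Mathlib

set_option maxSynthPendingDepth 3 in
/-- A normed space `X` over `𝕜` (`ℝ` or `ℂ`) is L-embedded if there is an L-projection `P` on the
bidual, that is `P ^ 2 = P` and `‖x‖ = ‖P x‖ + ‖x - P x‖` for all `x` in the bidual, whose
range is the canonical image of `X`. -/
def IsLEmbedded (𝕜 : Type*) (X : Type*) [RCLike 𝕜] [NormedAddCommGroup X]
    [NormedSpace 𝕜 X] : Prop :=
  ∃ P : StrongDual 𝕜 (StrongDual 𝕜 X) →L[𝕜] StrongDual 𝕜 (StrongDual 𝕜 X),
    IsLprojection (StrongDual 𝕜 (StrongDual 𝕜 X)) P ∧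
      Set.range P = Set.range (NormedSpace.inclusionInDoubleDual 𝕜 X)

universe u v v' w

/-- `X` is the unique isometric predual of its dual (among Banach spaces in the universe `w`):
`X` is linearly isometric to any Banach space `Z` whose dual is linearly isometric to the
dual of `X`. -/
def IsUniquePredual (𝕜 : Type u) (X : Type v) [RCLike 𝕜] [NormedAddCommGroup X]
    [NormedSpace 𝕜 X] : Prop :=
  ∀ (Z : Type w) [NormedAddCommGroup Z] [NormedSpace 𝕜 Z] [CompleteSpace Z],
    Nonempty (StrongDual 𝕜 Z ≃ₗᵢ[𝕜] StrongDual 𝕜 X) → Nonempty (X ≃ₗᵢ[𝕜] Z)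

/-!
The proof rests on property (X) of Godefroy and Talagrand (`HasPropertyX`): an element of the
bidual lies in the space as soon as it commutes with the weak* sums of weakly unconditionally Cauchy
(wuC) series in the dual.

*Property (X) gives uniqueness of the predual* (`HasPropertyX.isUniquePredual`). The weak* sum of a
wuC series does not depend on the predual (`IsWUC.tendsto_apply_of_dual_isometry`). Indeed, let `d`
be the difference of two such sums. Since the dual norm is lower semicontinuous for both weak*
topologies, adding `d` to a vector costs, up to `ε`, no more norm than subtracting a suitable block
of the series. Doing this `j` times with disjoint blocks bounds `j * ‖d‖` by the bound on finite sums
plus `j * ε`, so `d = 0` (`IsWUC.limit_unique`). Hence all elements of another predual, viewed in the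
bidual, commute with wuC sums, and property (X) places them in the space; a closed subspace that
separates the points of the dual is everything. Property (X) passes to isomorphic copies of closed
subspaces (`HasPropertyX.of_equiv_submodule`).

*Separable L-embedded spaces have property (X)* (`IsLEmbedded.hasPropertyX`). Let `P` be the
L-projection, `P Φ = 0`, and `f` in the dual. The adjoint `P*` is an M-projection, that is
`‖P* g + (1 - P*) h‖ ≤ max ‖g‖ ‖h‖`. If `a` and `a + s` have norm at most `C`, then so have
`a + P* s = P* (a + s) + (1 - P*) a` and `(a + s) - P* s = P* a + (1 - P*) (a + s)`. By Hahn-Banach,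
`P* s` may be replaced by an element `x` of the dual itself, at the price of a small error and with
prescribed approximate values on finitely many elements of the bidual
(`exists_approx_of_isLprojection`). Applied successively to the remainders `s` of `f`, with `a`
running through all finite sums of the terms already chosen, this yields a wuC series. Its
remainders tend weak* to zero because they are close to `(1 - P*) s`, which vanishes on `X`, on more
and more points of a dense sequence. Its terms are almost annihilated by `Φ` because
`(P* s) Φ = s (P Φ) = 0` (`exists_isWUC_of_isLprojection`). Thus a `Φ` that commutes with wuC sums
vanishes at every `f`.
-/

open Filter Topology NormedSpace

/-! ### Approximating elements of the bidual by Hahn-Banach -/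

section Approximation

variable {𝕜 V E F : Type*} [RCLike 𝕜] [NormedAddCommGroup V] [NormedSpace 𝕜 V]
  [NormedAddCommGroup E] [NormedSpace 𝕜 E] [NormedAddCommGroup F] [NormedSpace 𝕜 F]

/-- `‖T** φ + e‖ ≤ C` in the bidual of `E`, where `e : E` is identified with its canonical image,
expressed by testing against the functionals on `E`. -/
def BidualNormLE (φ : StrongDual 𝕜 (StrongDual 𝕜 V)) (T : V →L[𝕜] E) (e : E) (C : ℝ) : Prop :=
  ∀ G : StrongDual 𝕜 E, ‖φ (G.comp T) + G e‖ ≤ C * ‖G‖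

/-- Dual distance formula: modulo the range of `T`, the vector `e` is not affected by `T** φ`, so
its distance to that range is at most `C`. -/
theorem BidualNormLE.exists_norm_lt {φ : StrongDual 𝕜 (StrongDual 𝕜 V)} {T : V →L[𝕜] E} {e : E}
    {C : ℝ} (hC : 0 ≤ C) (h : BidualNormLE φ T e C) {D : ℝ} (hD : C < D) : ∃ v : V, ‖T v + e‖ < D := by
  let R : Submodule 𝕜 E := LinearMap.range T.toLinearMap
  obtain ⟨g, hg1, hg2⟩ := exists_dual_vector'' 𝕜 (R.mkQ e)
  let G : StrongDual 𝕜 E := LinearMap.mkContinuous (g.toLinearMap ∘ₗ R.mkQ) 1 fun x => by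
    refine (g.le_opNorm _).trans ?_
    exact mul_le_mul hg1 (Submodule.Quotient.norm_mk_le _ x) (norm_nonneg _) zero_le_one
  have hG : ‖G‖ ≤ 1 := LinearMap.mkContinuous_norm_le _ zero_le_one _
  have hGT : G.comp T = 0 := by
    ext x
    have hx : T x ∈ R := ⟨x, rfl⟩
    change g (Submodule.Quotient.mk (T x)) = 0
    rw [(Submodule.Quotient.mk_eq_zero R).2 hx, map_zero]
  have hGe : G e = (‖R.mkQ e‖ : 𝕜) := hg2
  have heD : ‖R.mkQ e‖ < D := by
    have := h G
    rw [hGT, map_zero, zero_add, hGe] at this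
    simp only [RCLike.norm_ofReal, abs_norm] at this
    exact (this.trans (mul_le_of_le_one_right hC hG)).trans_lt hD
  obtain ⟨m, hm, hmD⟩ := Submodule.Quotient.norm_mk_lt (R.mkQ e) (sub_pos.2 heD)
  obtain ⟨v, hv⟩ := (Submodule.Quotient.eq _).1 hm
  refine ⟨v, ?_⟩
  have hv' : T v = m - e := hv
  rw [hv', sub_add_cancel]
  linarith

/-- A functional of norm `‖g‖` takes every value `b` with `‖b‖ ≤ C * ‖g‖` on each ball of radius
larger than `C`. -/
theorem exists_apply_eq_of_norm_le (g : StrongDual 𝕜 E) {b : 𝕜} {C D : ℝ} (hC : 0 ≤ C)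
    (hb : ‖b‖ ≤ C * ‖g‖) (hD : C < D) : ∃ w : E, ‖w‖ ≤ D ∧ g w = b := by
  by_cases h0 : b = 0
  · exact ⟨0, by simpa using hC.trans hD.le, by simp [h0]⟩
  have hb0 : 0 < ‖b‖ := norm_pos_iff.2 h0
  have hg : 0 < ‖g‖ := by
    by_contra! h
    nlinarith [norm_nonneg g]
  have hD0 : 0 < D := hC.trans_lt hD
  obtain ⟨x, hx, hx'⟩ := g.exists_lt_apply_of_lt_opNorm (r := ‖b‖ / D)
    ((div_lt_iff₀ hD0).2 (by nlinarith))
  have hgx : 0 < ‖g x‖ := (by positivity : 0 ≤ ‖b‖ / D).trans_lt hx'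
  refine ⟨(b / g x) • x, ?_, ?_⟩
  · rw [norm_smul, norm_div]
    have : ‖b‖ / ‖g x‖ ≤ D := by
      rw [div_lt_iff₀ hD0] at hx'
      rw [div_le_iff₀ hgx]; linarith
    calc _ ≤ D * 1 := mul_le_mul this hx.le (norm_nonneg _) hD0.le
      _ = D := mul_one D
  · rw [map_smul, smul_eq_mul, div_mul_cancel₀ _ (norm_pos_iff.1 hgx)]

/-- A pointwise form of Goldstine's theorem: `T** φ + e` has norm at most `C` if and only if, as seen
by any single functional `G`, it lies in the image of each ball of radius larger than `C`. -/
theorem bidualNormLE_iff {φ : StrongDual 𝕜 (StrongDual 𝕜 V)} {T : V →L[𝕜] E} {e : E} {C : ℝ}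
    (hC : 0 ≤ C) : BidualNormLE φ T e C ↔
      ∀ D > C, ∀ G : StrongDual 𝕜 E, ∃ w : E, ‖w‖ ≤ D ∧ G w = φ (G.comp T) + G e := by
  refine ⟨fun h D hD G => exists_apply_eq_of_norm_le G hC (h G) hD, fun h G => ?_⟩
  have key : ∀ D ∈ Set.Ioi C, ‖φ (G.comp T) + G e‖ ≤ D * ‖G‖ := fun D hD => by
    obtain ⟨w, hw, hGw⟩ := h D hD G
    rw [← hGw, mul_comm]
    exact (G.le_opNorm w).trans (mul_le_mul_of_nonneg_left hw (norm_nonneg G))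
  have hlim : Tendsto (fun D : ℝ => D * ‖G‖) (𝓝[>] C) (𝓝 (C * ‖G‖)) :=
    ((continuous_id.mul continuous_const).tendsto C).mono_left nhdsWithin_le_nhds
  exact ge_of_tendsto hlim (eventually_mem_nhdsWithin.mono key)

theorem BidualNormLE.prod {φ : StrongDual 𝕜 (StrongDual 𝕜 V)} {T : V →L[𝕜] E} {e : E}
    {S : V →L[𝕜] F} {f : F} {C : ℝ} (hC : 0 ≤ C) (hT : BidualNormLE φ T e C)
    (hS : BidualNormLE φ S f C) : BidualNormLE φ (T.prod S) (e, f) C := by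
  refine (bidualNormLE_iff hC).2 fun D hD G => ?_
  obtain ⟨u, hu, hGu⟩ := (bidualNormLE_iff hC).1 hT D hD (G.comp (.inl 𝕜 E F))
  obtain ⟨w, hw, hGw⟩ := (bidualNormLE_iff hC).1 hS D hD (G.comp (.inr 𝕜 E F))
  have hG : ∀ p : E × F, G p = G.comp (.inl 𝕜 E F) p.1 + G.comp (.inr 𝕜 E F) p.2 := fun p => by
    simp [← map_add]
  have hGT : G.comp (T.prod S) =
      (G.comp (.inl 𝕜 E F)).comp T + (G.comp (.inr 𝕜 E F)).comp S := by
    ext v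
    exact hG _
  refine ⟨(u, w), by simpa [Prod.norm_def] using ⟨hu, hw⟩, ?_⟩
  rw [hG (u, w), hG (e, f), hGT, map_add, hGu, hGw]
  abel

theorem BidualNormLE.pi {ι : Type*} [Fintype ι] {φ : StrongDual 𝕜 (StrongDual 𝕜 V)}
    {T : ι → V →L[𝕜] E} {e : ι → E} {C : ℝ} (hC : 0 ≤ C)
    (h : ∀ i, BidualNormLE φ (T i) (e i) C) : BidualNormLE φ (ContinuousLinearMap.pi T) e C := by
  classical
  refine (bidualNormLE_iff hC).2 fun D hD G => ?_
  let s : ι → E →L[𝕜] (ι → E) := fun i => .single 𝕜 (fun _ => E) i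
  choose w hw hGw using fun i => (bidualNormLE_iff hC).1 (h i) D hD (G.comp (s i))
  have hG : ∀ p : ι → E, G p = ∑ i, G.comp (s i) (p i) := fun p => by
    conv_lhs => rw [← Finset.univ_sum_single p]
    rw [map_sum]
    rfl
  have hGT : G.comp (ContinuousLinearMap.pi T) = ∑ i, (G.comp (s i)).comp (T i) := by
    ext v
    rw [sum_apply]
    exact hG _
  refine ⟨w, (pi_norm_le_iff_of_nonneg (hC.trans hD.le)).2 hw, ?_⟩
  rw [hG w, hG e, hGT, map_sum, ← Finset.sum_add_distrib]
  exact Finset.sum_congr rfl fun i _ => hGw i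

end Approximation

/-! ### Weakly unconditionally Cauchy series and property (X) -/

section PropertyX

/-- A series is weakly unconditionally Cauchy. The definition used here, that the sums over finite
sets of indices are bounded in norm, is equivalent to `∑ ‖G (x k)‖ < ∞` for all functionals `G`. -/
def IsWUC {V : Type*} [NormedAddCommGroup V] (x : ℕ → V) : Prop :=
  ∃ M : ℝ, ∀ A : Finset ℕ, ‖∑ k ∈ A, x k‖ ≤ M

variable (𝕜 : Type*) [RCLike 𝕜]

/-- `F` in the bidual of `Y` commutes with the weak* sums of weakly unconditionally Cauchy series
in the dual of `Y`. -/
def CommutesWithWUCSums {Y : Type*} [NormedAddCommGroup Y] [NormedSpace 𝕜 Y]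
    (F : StrongDual 𝕜 (StrongDual 𝕜 Y)) : Prop :=
  ∀ x : ℕ → StrongDual 𝕜 Y, IsWUC x → ∀ s : StrongDual 𝕜 Y,
    (∀ y, Tendsto (fun n => (∑ k ∈ Finset.range n, x k) y) atTop (𝓝 (s y))) →
      Tendsto (fun n => F (∑ k ∈ Finset.range n, x k)) atTop (𝓝 (F s))

/-- Property (X) of Godefroy and Talagrand: an element of the bidual that commutes with the
weak* sums of weakly unconditionally Cauchy series comes from the space. -/
def HasPropertyX (Y : Type*) [NormedAddCommGroup Y] [NormedSpace 𝕜 Y] : Prop :=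
  ∀ F : StrongDual 𝕜 (StrongDual 𝕜 Y), CommutesWithWUCSums 𝕜 F →
    F ∈ Set.range (inclusionInDoubleDual 𝕜 Y)

variable {𝕜}

/-- Two limits of the partial sums of a weakly unconditionally Cauchy series agree if the closed
balls that eventually contain the partial sums contain both limits. -/
theorem IsWUC.limit_unique {V : Type*} [NormedAddCommGroup V] [NormedSpace ℝ V] {x : ℕ → V}
    (hx : IsWUC x) {a b : V}
    (ha : ∀ v : V, ∀ r : ℝ, (∀ᶠ n in atTop, ‖v + ∑ k ∈ Finset.range n, x k‖ ≤ r) → ‖v + a‖ ≤ r)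
    (hb : ∀ v : V, ∀ r : ℝ, (∀ᶠ n in atTop, ‖v - ∑ k ∈ Finset.range n, x k‖ ≤ r) → ‖v - b‖ ≤ r) :
    a = b := by
  obtain ⟨M, hM⟩ := hx
  -- Adding `a - b` costs no more norm than subtracting a suitable block of the series: letting
  -- first the upper and then the lower end of the block tend to infinity turns it into `b - a`.
  have hblock : ∀ (v : V) (N : ℕ) (ε : ℝ), 0 < ε → ∃ m ≥ N, ∃ n ≥ m,
      ‖v + (a - b)‖ ≤ ‖v - ∑ k ∈ Finset.Ico m n, x k‖ + ε := by
    intro v N ε hε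
    by_contra! h
    have h1 : ∀ m ≥ N, ‖v - b + ∑ k ∈ Finset.range m, x k‖ ≤ ‖v + (a - b)‖ - ε := by
      intro m hm
      have := hb (v + ∑ k ∈ Finset.range m, x k) (‖v + (a - b)‖ - ε) <| by
        filter_upwards [eventually_ge_atTop m] with n hn
        have h2 := h m hm n hn
        rw [Finset.sum_Ico_eq_sub _ hn, ← sub_add, sub_add_eq_add_sub] at h2
        linarith
      rwa [add_sub_right_comm] at this
    have h2 := ha (v - b) _ ((eventually_ge_atTop N).mono h1)
    rw [sub_add_eq_add_sub, ← add_sub] at h2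
    linarith
  have hiter : ∀ (ε : ℝ), 0 < ε → ∀ (j : ℕ) (v : V) (N : ℕ), ∃ A : Finset ℕ, (∀ k ∈ A, N ≤ k) ∧
      ‖v + j • (a - b)‖ ≤ ‖v - ∑ k ∈ A, x k‖ + j * ε := by
    intro ε hε j
    induction j with
    | zero => exact fun v N => ⟨∅, by simp, by simp⟩
    | succ j ih =>
      intro v N
      obtain ⟨m, hm, n, hn, h1⟩ := hblock (v + j • (a - b)) N ε hε
      obtain ⟨A, hA, h2⟩ := ih (v - ∑ k ∈ Finset.Ico m n, x k) n
      have hdisj : Disjoint (Finset.Ico m n) A := by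
        rw [Finset.disjoint_left]
        intro k hk hkA
        have := hA k hkA
        have := (Finset.mem_Ico.1 hk).2
        omega
      refine ⟨Finset.Ico m n ∪ A, fun k hk => ?_, ?_⟩
      · rcases Finset.mem_union.1 hk with hk | hk
        · exact hm.trans (Finset.mem_Ico.1 hk).1
        · exact (hm.trans hn).trans (hA k hk)
      · rw [Finset.sum_union hdisj, ← sub_sub, succ_nsmul, ← add_assoc]
        rw [add_sub_right_comm] at h1
        push_cast
        linarith
  by_contra hab
  have hd : 0 < ‖a - b‖ := norm_pos_iff.2 (sub_ne_zero.2 hab)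
  obtain ⟨j, hj⟩ := exists_nat_gt (M / (‖a - b‖ / 2))
  obtain ⟨A, -, h⟩ := hiter (‖a - b‖ / 2) (by positivity) j 0 0
  rw [zero_add, zero_sub, norm_neg, ← Nat.cast_smul_eq_nsmul ℝ, norm_smul] at h
  rw [div_lt_iff₀ (by positivity)] at hj
  have := hM A
  simp only [Real.norm_natCast] at h
  linarith

/-- The norm of a dual space is weak* lower semicontinuous. -/
theorem norm_le_of_tendsto_apply {Y ι : Type*} [NormedAddCommGroup Y] [NormedSpace 𝕜 Y]
    {l : Filter ι} [l.NeBot] {f : ι → StrongDual 𝕜 Y} {g : StrongDual 𝕜 Y} {r : ℝ}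
    (hf : ∀ y, Tendsto (fun i => f i y) l (𝓝 (g y))) (hr : ∀ᶠ i in l, ‖f i‖ ≤ r) : ‖g‖ ≤ r := by
  obtain ⟨i, hi⟩ := hr.exists
  refine g.opNorm_le_bound ((norm_nonneg _).trans hi) fun y => ?_
  exact le_of_tendsto (hf y).norm (hr.mono fun i hi => (f i).le_of_opNorm_le hi y)

/-- The weak* sum of a weakly unconditionally Cauchy series does not depend on the predual. -/
theorem IsWUC.tendsto_apply_of_dual_isometry {Y Z : Type*} [NormedAddCommGroup Y] [NormedSpace 𝕜 Y]
    [NormedAddCommGroup Z] [NormedSpace 𝕜 Z] (e : StrongDual 𝕜 Y ≃ₗᵢ[𝕜] StrongDual 𝕜 Z)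
    {x : ℕ → StrongDual 𝕜 Y} (hx : IsWUC x) {s : StrongDual 𝕜 Y}
    (hs : ∀ y, Tendsto (fun n => (∑ k ∈ Finset.range n, x k) y) atTop (𝓝 (s y))) (z : Z) :
    Tendsto (fun n => e (∑ k ∈ Finset.range n, x k) z) atTop (𝓝 (e s z)) := by
  -- By Banach-Alaoglu, the partial sums have a weak* limit with respect to `Z` along every ultrafilter
  -- finer than `atTop`; it has to be shown that this limit is `s`.
  rw [tendsto_iff_ultrafilter]
  intro U hU
  obtain ⟨M, hM⟩ := id hx
  let S : ℕ → WeakDual 𝕜 Z := fun n => StrongDual.toWeakDual (e (∑ k ∈ Finset.range n, x k))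
  have hS : ∀ n, S n ∈ WeakDual.toStrongDual ⁻¹' Metric.closedBall (0 : StrongDual 𝕜 Z) M := by
    intro n
    rw [Set.mem_preimage, mem_closedBall_zero_iff]
    exact (e.norm_map _).trans_le (hM _)
  obtain ⟨t, -, ht⟩ := (WeakDual.isCompact_closedBall (0 : StrongDual 𝕜 Z) M).ultrafilter_le_nhds
    (U.map S) (le_principal_iff.2 (Ultrafilter.mem_map.2 (univ_mem' hS)))
  let b : StrongDual 𝕜 Y := e.symm (WeakDual.toStrongDual t)
  have hb : ∀ z, Tendsto (fun n => e (∑ k ∈ Finset.range n, x k) z) U (𝓝 (e b z)) := by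
    intro z
    have h : Tendsto S U (𝓝 t) := ht
    have hbz : e b = WeakDual.toStrongDual t := e.apply_symm_apply _
    rw [hbz]
    exact ((WeakDual.eval_continuous z).tendsto t).comp h
  have hsb : s = b := by
    let _ : NormedSpace ℝ (StrongDual 𝕜 Y) := NormedSpace.restrictScalars ℝ 𝕜 _
    refine hx.limit_unique (fun v r hr => ?_) fun v r hr => ?_
    · exact norm_le_of_tendsto_apply (fun y => (hs y).const_add (v y)) hr
    · rw [← e.norm_map]
      refine norm_le_of_tendsto_apply 
        (f := fun n => e (v - ∑ k ∈ Finset.range n, x k)) (l := U) (fun z => ?_) ?_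
      · simpa only [map_sub, sub_apply] using (hb z).const_sub (e v z)
      · filter_upwards [hU hr] with n hn
        rwa [e.norm_map]
  rw [hsb]
  exact hb z

/-- A closed subspace is the intersection of the kernels of the functionals vanishing on it. -/
theorem exists_dual_ne_zero_of_notMem {Y : Type*} [NormedAddCommGroup Y] [NormedSpace 𝕜 Y]
    {W : Submodule 𝕜 Y} (hW : IsClosed (W : Set Y)) {y : Y} (hy : y ∉ W) :
    ∃ f : StrongDual 𝕜 Y, (∀ w ∈ W, f w = 0) ∧ f y ≠ 0 := by
  have hmk : ∀ v : Y, W.mkQL v = 0 ↔ v ∈ W := fun v => Submodule.Quotient.mk_eq_zero W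
  -- The norm on the quotient is definite because of this instance.
  have := hW
  obtain ⟨g, -, hg⟩ := exists_dual_vector 𝕜 (W.mkQL y) (norm_ne_zero_iff.2 (mt (hmk y).1 hy))
  refine ⟨g.comp W.mkQL, fun w hw => ?_, ?_⟩
  · rw [ContinuousLinearMap.comp_apply, (hmk w).2 hw, map_zero]
  · rw [ContinuousLinearMap.comp_apply, hg]
    exact_mod_cast norm_ne_zero_iff.2 (mt (hmk y).1 hy)

/-- If `Z` embeds isometrically into a copy of `Y` and its image separates the functionals on `Y`,
then `Z` is isometric to `Y`. -/
theorem nonempty_linearIsometryEquiv_of_forall_dual {Y Z E : Type*} [NormedAddCommGroup Y]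
    [NormedSpace 𝕜 Y] [NormedAddCommGroup Z] [NormedSpace 𝕜 Z] [CompleteSpace Z]
    [NormedAddCommGroup E] [NormedSpace 𝕜 E] (J : Y →ₗᵢ[𝕜] E) (K : Z →ₗᵢ[𝕜] E)
    (hKJ : ∀ z, ∃ y, J y = K z)
    (h : ∀ f : StrongDual 𝕜 Y, (∀ y z, J y = K z → f y = 0) → f = 0) :
    Nonempty (Y ≃ₗᵢ[𝕜] Z) := by
  let W : Submodule 𝕜 Y := (LinearMap.range K.toLinearMap).comap J.toLinearMap
  have hW : IsClosed (W : Set Y) := by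
    have : IsClosed (Set.range K) := K.isometry.isClosedEmbedding.isClosed_range
    exact this.preimage J.continuous
  have hWtop : ∀ y, y ∈ W := by
    by_contra! ⟨y, hy⟩
    obtain ⟨f, hf, hfy⟩ := exists_dual_ne_zero_of_notMem hW hy
    exact hfy (by rw [h f fun y z hyz => hf y ⟨z, hyz.symm⟩]; rfl)
  have hrange : LinearMap.range J.toLinearMap = LinearMap.range K.toLinearMap := by
    apply le_antisymm
    · rintro _ ⟨y, rfl⟩
      exact hWtop y
    · rintro _ ⟨z, rfl⟩
      exact hKJ z
  exact ⟨J.equivRange.trans ((LinearIsometryEquiv.ofEq _ _ hrange).trans K.equivRange.symm)⟩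

/-- The embedding of `Z` into the bidual of `Y` induced by an isometry of the dual spaces. -/
noncomputable def predualEmbedding {Y Z : Type*} [NormedAddCommGroup Y] [NormedSpace 𝕜 Y]
    [NormedAddCommGroup Z] [NormedSpace 𝕜 Z] (e : StrongDual 𝕜 Y ≃ₗᵢ[𝕜] StrongDual 𝕜 Z) :
    Z →ₗᵢ[𝕜] StrongDual 𝕜 (StrongDual 𝕜 Y) where
  toLinearMap :=
    (((e.toContinuousLinearEquiv : StrongDual 𝕜 Y →L[𝕜] StrongDual 𝕜 Z).precomp 𝕜).comp
      (inclusionInDoubleDual 𝕜 Z)).toLinearMap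
  norm_map' z := (ContinuousLinearMap.opNorm_comp_linearIsometryEquiv
    (inclusionInDoubleDual 𝕜 Z z) e).trans ((inclusionInDoubleDualLi 𝕜).norm_map z)

theorem predualEmbedding_apply_apply {Y Z : Type*} [NormedAddCommGroup Y] [NormedSpace 𝕜 Y]
    [NormedAddCommGroup Z] [NormedSpace 𝕜 Z] (e : StrongDual 𝕜 Y ≃ₗᵢ[𝕜] StrongDual 𝕜 Z) (z : Z)
    (f : StrongDual 𝕜 Y) : predualEmbedding e z f = e f z :=
  rfl

/-- Property (X) puts any isometric predual `Z` of the dual of `Y` inside `Y`, and a closed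
subspace of `Y` that separates the points of the dual of `Y` is all of `Y`. -/
theorem HasPropertyX.isUniquePredual {𝕜 : Type u} [RCLike 𝕜] {Y : Type v} [NormedAddCommGroup Y]
    [NormedSpace 𝕜 Y] (hY : HasPropertyX 𝕜 Y) : IsUniquePredual.{u, v, w} 𝕜 Y := by
  intro Z _ _ _ ⟨e⟩
  have hKJ : ∀ z, ∃ y, inclusionInDoubleDual 𝕜 Y y = predualEmbedding e.symm z := fun z =>
    hY _ fun x hx s hs => by
      simp only [predualEmbedding_apply_apply]
      exact hx.tendsto_apply_of_dual_isometry e.symm hs z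
  refine nonempty_linearIsometryEquiv_of_forall_dual (E := StrongDual 𝕜 (StrongDual 𝕜 Y))
    (inclusionInDoubleDualLi 𝕜) (predualEmbedding e.symm) hKJ fun f hf => ?_
  have hf0 : e.symm f = 0 := by
    ext z
    obtain ⟨w, hw⟩ := hKJ z
    rw [← predualEmbedding_apply_apply, ← hw]
    exact hf w z hw
  simpa using hf0

/-- Property (X) is invariant under isomorphisms and passes to complete subspaces. -/
theorem HasPropertyX.of_equiv_submodule {X Y : Type*} [NormedAddCommGroup X] [NormedSpace 𝕜 X]
    [NormedAddCommGroup Y] [NormedSpace 𝕜 Y] [CompleteSpace Y] (hX : HasPropertyX 𝕜 X)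
    {M : Submodule 𝕜 X} (e : Y ≃L[𝕜] M) : HasPropertyX 𝕜 Y := by
  intro F hF
  let j : Y →L[𝕜] X := M.subtypeL.comp (e : Y →L[𝕜] M)
  -- `restr` is the adjoint of `j`, and `F.comp restr` is the image of `F` under its biadjoint.
  let restr : StrongDual 𝕜 X →L[𝕜] StrongDual 𝕜 Y := j.precomp 𝕜
  obtain ⟨x, hx⟩ := hX (F.comp restr) fun f hf s hs => by
    obtain ⟨B, hB⟩ := hf
    have hwuc : IsWUC fun k => restr (f k) := by
      refine ⟨‖restr‖ * B, fun A => ?_⟩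
      rw [← map_sum]
      exact (restr.le_opNorm _).trans (mul_le_mul_of_nonneg_left (hB A) (norm_nonneg _))
    have := hF _ hwuc (restr s) fun y => by
      simp_rw [← map_sum]
      exact hs (j y)
    simp only [← map_sum] at this
    exact this
  have hx' : ∀ f : StrongDual 𝕜 X, f x = F (restr f) := fun f => DFunLike.congr_fun hx f
  have hM : IsClosed (M : Set X) := by
    have : CompleteSpace M :=
      (completeSpace_congr (e := e.toLinearEquiv.toEquiv) e.isUniformEmbedding).1 inferInstance
    exact (completeSpace_coe_iff_isComplete.1 this).isClosed
  have hxM : x ∈ M := by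
    by_contra h
    obtain ⟨f, hf, hfx⟩ := exists_dual_ne_zero_of_notMem hM h
    have : restr f = 0 := by
      ext y
      exact hf _ (e y).2
    rw [hx', this, map_zero] at hfx
    exact hfx rfl
  refine ⟨e.symm ⟨x, hxM⟩, ?_⟩
  ext g
  obtain ⟨f, hf, -⟩ := exists_extension_norm_eq M (g.comp (e.symm : M →L[𝕜] Y))
  have hfg : restr f = g := by
    ext y
    exact (hf (e y)).trans (congrArg g (e.symm_apply_apply y))
  rw [← hfg, ← hx', dual_def, hfg]
  exact (hf ⟨x, hxM⟩).symm

end PropertyX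

/-! ### Separable L-embedded spaces -/

section LEmbedded

variable {𝕜 X : Type*} [RCLike 𝕜] [NormedAddCommGroup X] [NormedSpace 𝕜 X]
  {P : StrongDual 𝕜 (StrongDual 𝕜 X) →L[𝕜] StrongDual 𝕜 (StrongDual 𝕜 X)}

/-- The adjoint of an L-projection `P` is an M-projection: this is the bound
`‖P* g + (1 - P*) h‖ ≤ max ‖g‖ ‖h‖` for `g` and `h` in the dual of `X`. -/
theorem norm_apply_add_apply_le_of_isLprojection
    (hL : ∀ G, ‖G‖ = ‖P G‖ + ‖G - P G‖) {g h : StrongDual 𝕜 X} {C : ℝ}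
    (hg : ‖g‖ ≤ C) (hh : ‖h‖ ≤ C) (G : StrongDual 𝕜 (StrongDual 𝕜 X)) :
    ‖P G g + (G - P G) h‖ ≤ C * ‖G‖ := by
  calc ‖P G g + (G - P G) h‖ ≤ ‖P G g‖ + ‖(G - P G) h‖ := norm_add_le _ _
    _ ≤ ‖P G‖ * C + ‖G - P G‖ * C :=
      add_le_add ((P G).le_opNorm_of_le hg) ((G - P G).le_opNorm_of_le hh)
    _ = C * ‖G‖ := by rw [hL G]; ring

/-- The functional `P* s` can be approximated, on finitely many elements of the bidual, by some
`x` in the dual of `X` which satisfies, up to `δ`, the norm estimates for `a + x` and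
`a + s - x` that the adjoint of the L-projection gives for `P* s` in place of `x`. -/
theorem exists_approx_of_isLprojection
    (hL : ∀ G, ‖G‖ = ‖P G‖ + ‖G - P G‖) (A : Finset (StrongDual 𝕜 X))
    (J : Finset (StrongDual 𝕜 (StrongDual 𝕜 X))) {s : StrongDual 𝕜 X} {C δ : ℝ} (hC : 0 ≤ C)
    (hδ : 0 < δ) (hA : ∀ a ∈ A, ‖a‖ ≤ C ∧ ‖a + s‖ ≤ C) :
    ∃ x : StrongDual 𝕜 X, (∀ a ∈ A, ‖a + x‖ ≤ C + δ ∧ ‖a + s - x‖ ≤ C + δ) ∧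
      ∀ Φ ∈ J, ‖Φ x - P Φ s‖ ≤ δ := by
  let φ : StrongDual 𝕜 (StrongDual 𝕜 (StrongDual 𝕜 X)) :=
    (inclusionInDoubleDual 𝕜 (StrongDual 𝕜 X) s).comp P
  have hφ : ∀ G, φ G = P G s := fun _ => rfl
  have h1 : ∀ a : A, BidualNormLE φ (ContinuousLinearMap.id 𝕜 _) a.1 C := fun a G => by
    convert norm_apply_add_apply_le_of_isLprojection hL (hA a a.2).2 (hA a a.2).1 G using 2
    rw [ContinuousLinearMap.comp_id, hφ, map_add, sub_apply]
    ring
  have h2 : ∀ a : A, BidualNormLE φ (-ContinuousLinearMap.id 𝕜 _) (a.1 + s) C := fun a G => by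
    convert norm_apply_add_apply_le_of_isLprojection hL (hA a a.2).1 (hA a a.2).2 G using 2
    rw [ContinuousLinearMap.comp_neg, ContinuousLinearMap.comp_id, map_neg, hφ, sub_apply,
      map_add (P G)]
    ring
  -- The scaling by `c` turns an error `C + δ` into the error `δ`.
  let c : ℝ := (C + δ) / δ
  have hc : 0 < c := by positivity
  have h3 : ∀ Φ : J, BidualNormLE φ ((c : 𝕜) • Φ.1) (-((c : 𝕜) * P Φ.1 s)) C := fun Φ G => by
    have hG : G.comp ((c : 𝕜) • Φ.1) = ((c : 𝕜) * G 1) • Φ.1 := by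
      ext x
      have : G ((c : 𝕜) * Φ.1 x) = ((c : 𝕜) * Φ.1 x) * G 1 := by
        rw [← smul_eq_mul ((c : 𝕜) * Φ.1 x) (G 1), ← map_smul, smul_eq_mul, mul_one]
      simp only [ContinuousLinearMap.comp_apply, smul_apply, smul_eq_mul, this]
      ring
    have hG' : G (-((c : 𝕜) * P Φ.1 s)) = -((c : 𝕜) * P Φ.1 s) * G 1 := by
      rw [← smul_eq_mul _ (G 1), ← map_smul, smul_eq_mul, mul_one]
    rw [hG, hG', map_smul, hφ, smul_eq_mul]
    have : (c : 𝕜) * G 1 * P Φ.1 s + -((c : 𝕜) * P Φ.1 s) * G 1 = 0 := by ring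
    rw [this, norm_zero]
    positivity
  obtain ⟨x, hx⟩ := (((BidualNormLE.pi hC h1).prod hC (BidualNormLE.pi hC h2)).prod hC
    (BidualNormLE.pi hC h3)).exists_norm_lt hC (lt_add_of_pos_right C hδ)
  refine ⟨x, fun a ha => ⟨?_, ?_⟩, fun Φ hΦ => ?_⟩
  · have h := ((norm_fst_le _).trans ((norm_fst_le _).trans hx.le))
    rw [add_comm]
    exact (norm_le_pi_norm _ (⟨a, ha⟩ : A)).trans h
  · have h := ((norm_snd_le _).trans ((norm_fst_le _).trans hx.le))
    rw [sub_eq_neg_add]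
    exact (norm_le_pi_norm _ (⟨a, ha⟩ : A)).trans h
  · have h := (norm_le_pi_norm _ (⟨Φ, hΦ⟩ : J)).trans ((norm_snd_le _).trans hx.le)
    have h' : ‖(c : 𝕜) * Φ x + -((c : 𝕜) * P Φ s)‖ ≤ C + δ := h
    rw [← sub_eq_add_neg, ← mul_sub, norm_mul, RCLike.norm_ofReal, abs_of_pos hc] at h'
    have hcδ : c * δ = C + δ := div_mul_cancel₀ _ hδ.ne'
    rw [← hcδ] at h'
    exact le_of_mul_le_mul_left h' hc

/-- Pointwise convergence to zero of a bounded sequence of functionals need only be checked on a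
dense sequence. -/
theorem tendsto_apply_zero_of_dense {f : ℕ → StrongDual 𝕜 X} {B : ℝ} (hB : ∀ n, ‖f n‖ ≤ B)
    {u : ℕ → X} (hu : DenseRange u) (h : ∀ j, Tendsto (fun n => f n (u j)) atTop (𝓝 0)) (y : X) :
    Tendsto (fun n => f n y) atTop (𝓝 0) := by
  rw [Metric.tendsto_atTop]
  intro ε hε
  have hB0 : 0 ≤ B := (norm_nonneg _).trans (hB 0)
  obtain ⟨j, hj⟩ := hu.exists_dist_lt y (ε := ε / 2 / (B + 1)) (by positivity)
  obtain ⟨N, hN⟩ := Metric.tendsto_atTop.1 (h j) (ε / 2) (by positivity)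
  refine ⟨N, fun n hn => ?_⟩
  have h1 : ‖f n (u j)‖ < ε / 2 := by simpa using hN n hn
  have h2 : ‖f n (y - u j)‖ ≤ B * ‖y - u j‖ := (f n).le_of_opNorm_le (hB n) _
  rw [dist_eq_norm, lt_div_iff₀ (by positivity)] at hj
  rw [dist_zero_right]
  calc ‖f n y‖ = ‖f n (y - u j) + f n (u j)‖ := by rw [← map_add, sub_add_cancel]
    _ ≤ ‖f n (y - u j)‖ + ‖f n (u j)‖ := norm_add_le _ _
    _ < ε := by nlinarith [norm_nonneg (y - u j)]

/-- If `P` is an L-projection onto a separable space `X` and `P Φ = 0`, then every `f` in the dual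
of `X` is the weak* sum of a weakly unconditionally Cauchy series on whose partial sums `Φ`
is at most `1` in modulus, however large `Φ f` is. Each term `x n` approximates `P* s` for the
current remainder `s` of `f`. The L-projection enters only through `hL` and `hPX`. -/
theorem exists_isWUC_of_isLprojection [TopologicalSpace.SeparableSpace X]
    (hL : ∀ G, ‖G‖ = ‖P G‖ + ‖G - P G‖)
    (hPX : ∀ y, P (inclusionInDoubleDual 𝕜 X y) = inclusionInDoubleDual 𝕜 X y)
    {Φ : StrongDual 𝕜 (StrongDual 𝕜 X)} (hΦ : P Φ = 0) (f : StrongDual 𝕜 X) :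
    ∃ x : ℕ → StrongDual 𝕜 X, IsWUC x ∧
      (∀ y, Tendsto (fun n => (∑ k ∈ Finset.range n, x k) y) atTop (𝓝 (f y))) ∧
      ∀ n, ‖Φ (∑ k ∈ Finset.range n, x k)‖ ≤ 1 := by
  classical
  let u : ℕ → X := TopologicalSpace.denseSeq X
  let J : ℕ → Finset (StrongDual 𝕜 (StrongDual 𝕜 X)) := fun n =>
    insert Φ ((Finset.range (n + 1)).image fun j => inclusionInDoubleDual 𝕜 X (u j))
  let δ : ℕ → ℝ := fun n => (1 / 2) ^ (n + 1)
  let C : ℕ → ℝ := fun n => ‖f‖ + 1 - (1 / 2) ^ n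
  have hδ : ∀ n, 0 < δ n := fun n => by positivity
  have hC0 : ∀ n, 0 ≤ C n := fun n => by
    have : (1 / 2 : ℝ) ^ n ≤ 1 := pow_le_one₀ (by norm_num) (by norm_num)
    have := norm_nonneg f
    simp only [C]
    linarith
  have hCsucc : ∀ n, C n + δ n = C (n + 1) := fun n => by
    simp only [C, δ, pow_succ]
    ring
  have hCle : ∀ n, C n ≤ ‖f‖ + 1 := fun n => sub_le_self _ (by positivity)
  have hstep : ∀ (n : ℕ) (A : Finset (StrongDual 𝕜 X)) (s : StrongDual 𝕜 X),
      (∀ a ∈ A, ‖a‖ ≤ C n ∧ ‖a + s‖ ≤ C n) → ∃ x : StrongDual 𝕜 X,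
        (∀ a ∈ A, ‖a + x‖ ≤ C n + δ n ∧ ‖a + s - x‖ ≤ C n + δ n) ∧
          ∀ Ψ ∈ J n, ‖Ψ x - P Ψ s‖ ≤ δ n := fun n A s hA =>
    exists_approx_of_isLprojection hL A (J n) (hC0 n) (hδ n) hA
  choose! ξ hξ using hstep
  -- A state consists of all finite sums of the terms chosen so far and of the remainder of `f`.
  let st : ℕ → Finset (StrongDual 𝕜 X) × StrongDual 𝕜 X := fun n =>
    Nat.rec ({0}, f) (fun n p => (p.1 ∪ p.1.image (· + ξ n p.1 p.2), p.2 - ξ n p.1 p.2)) n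
  let x : ℕ → StrongDual 𝕜 X := fun n => ξ n (st n).1 (st n).2
  have hst1 : ∀ n, (st (n + 1)).1 = (st n).1 ∪ (st n).1.image (· + x n) := fun _ => rfl
  have hst2 : ∀ n, (st (n + 1)).2 = (st n).2 - x n := fun _ => rfl
  have hinv : ∀ n, ∀ a ∈ (st n).1, ‖a‖ ≤ C n ∧ ‖a + (st n).2‖ ≤ C n := by
    intro n
    induction n with
    | zero =>
      intro a ha
      obtain rfl : a = 0 := Finset.mem_singleton.1 ha
      simp [C, st]
    | succ n ih =>
      have hx := (hξ n _ _ ih).1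
      intro a ha
      rw [hst1, Finset.mem_union, Finset.mem_image] at ha
      rw [hst2, ← hCsucc]
      rcases ha with ha | ⟨a, ha, rfl⟩
      · refine ⟨(ih a ha).1.trans (le_add_of_nonneg_right (hδ n).le), ?_⟩
        rw [← add_sub_assoc]
        exact (hx a ha).2
      · refine ⟨(hx a ha).1, ?_⟩
        rw [add_add_sub_cancel]
        exact (ih a ha).2.trans (le_add_of_nonneg_right (hδ n).le)
  have happrox : ∀ n, ∀ Ψ ∈ J n, ‖Ψ (x n) - P Ψ (st n).2‖ ≤ δ n := fun n =>
    (hξ n _ _ (hinv n)).2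
  have hsum : ∀ n, (st n).2 = f - ∑ k ∈ Finset.range n, x k := by
    intro n
    induction n with
    | zero => simp [st]
    | succ n ih => rw [hst2, ih, Finset.sum_range_succ, sub_sub]
  have hmem : ∀ n, ∀ A ⊆ Finset.range n, ∑ k ∈ A, x k ∈ (st n).1 := by
    intro n
    induction n with
    | zero =>
      intro A hA
      obtain rfl : A = ∅ := by simpa using hA
      simp [st]
    | succ n ih =>
      intro A hA
      have hA' : A.erase n ⊆ Finset.range n := fun k hk => by
        have h1 := Finset.mem_range.1 (hA (Finset.mem_of_mem_erase hk))
        have h2 := Finset.ne_of_mem_erase hk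
        exact Finset.mem_range.2 (by omega)
      rw [hst1, Finset.mem_union, Finset.mem_image]
      by_cases hn : n ∈ A
      · exact .inr ⟨_, ih _ hA', Finset.sum_erase_add _ _ hn⟩
      · rw [Finset.erase_eq_of_notMem hn] at hA'
        exact .inl (ih A hA')
  have hδlim : Tendsto δ atTop (𝓝 0) :=
    (tendsto_add_atTop_iff_nat 1).2
      (tendsto_pow_atTop_nhds_zero_of_lt_one (by norm_num) (by norm_num))
  refine ⟨x, ⟨‖f‖ + 1, fun A => ?_⟩, fun y => ?_, fun n => ?_⟩
  · obtain ⟨n, hn⟩ := A.exists_nat_subset_range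
    exact (hinv n _ (hmem n A hn)).1.trans (hCle n)
  · have hB : ∀ n, ‖(st n).2‖ ≤ ‖f‖ + 1 := fun n => by
      have := (hinv n _ (hmem n ∅ (Finset.empty_subset _))).2
      rw [Finset.sum_empty, zero_add] at this
      exact this.trans (hCle n)
    have h0 := tendsto_apply_zero_of_dense hB (TopologicalSpace.denseRange_denseSeq X)
      (fun j => by
        rw [← tendsto_add_atTop_iff_nat 1]
        refine squeeze_zero_norm' ?_ hδlim
        filter_upwards [eventually_ge_atTop j] with n hn
        have := happrox n (inclusionInDoubleDual 𝕜 X (u j)) <| Finset.mem_insert_of_mem <|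
          Finset.mem_image_of_mem _ (Finset.mem_range.2 (by omega))
        rw [hPX, dual_def, dual_def, norm_sub_rev] at this
        rw [hst2]
        exact this) y
    have h1 : (fun n => (∑ k ∈ Finset.range n, x k) y) = fun n => f y - (st n).2 y := by
      ext n
      rw [hsum, sub_apply, sub_sub_cancel]
    rw [h1]
    simpa using h0.const_sub (f y)
  · have hx : ∀ k, ‖Φ (x k)‖ ≤ (1 / 2) ^ (k + 1) := fun k => by
      have := happrox k Φ (Finset.mem_insert_self _ _)
      rwa [hΦ, zero_apply, sub_zero] at this
    have hgeom : ∀ m : ℕ, ∑ k ∈ Finset.range m, (1 / 2 : ℝ) ^ (k + 1) = 1 - (1 / 2) ^ m := by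
      intro m
      induction m with
      | zero => simp
      | succ m ih => rw [Finset.sum_range_succ, ih, pow_succ]; ring
    rw [map_sum]
    refine (norm_sum_le_of_le _ fun k _ => hx k).trans ?_
    rw [hgeom]
    exact sub_le_self _ (by positivity)

set_option maxSynthPendingDepth 3 in
/-- Separable L-embedded spaces have property (X): the singular part `F - P F` of an element `F` of
the bidual that commutes with weak* sums vanishes on every functional. -/
theorem IsLEmbedded.hasPropertyX [TopologicalSpace.SeparableSpace X] (hX : IsLEmbedded 𝕜 X) :
    HasPropertyX 𝕜 X := by
  obtain ⟨P, hP, hrange⟩ := hX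
  have hL : ∀ G, ‖G‖ = ‖P G‖ + ‖G - P G‖ := hP.Lnorm
  have hidem : ∀ G, P (P G) = P G := fun G => DFunLike.congr_fun hP.proj G
  have hPX : ∀ y, P (inclusionInDoubleDual 𝕜 X y) = inclusionInDoubleDual 𝕜 X y := fun y => by
    obtain ⟨G, hG⟩ := hrange.symm ▸ Set.mem_range_self (f := inclusionInDoubleDual 𝕜 X) y
    rw [← hG, hidem]
  intro F hF
  obtain ⟨y, hy⟩ := hrange ▸ Set.mem_range_self (f := P) F
  have hΦ : P (F - P F) = 0 := by rw [map_sub, hidem, sub_self]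
  have hsing : F - P F = 0 := by
    ext f
    by_contra hne
    rw [zero_apply] at hne
    -- After rescaling `f`, the partial sums have values at most `1` under `F - P F`, but `f` itself
    -- has the value `2`.
    set c : 𝕜 := (F - P F) f with hc
    obtain ⟨x, hx, hlim, hbound⟩ := exists_isWUC_of_isLprojection hL hPX hΦ ((2 / c) • f)
    have h1 : Tendsto (fun n => (F - P F) (∑ k ∈ Finset.range n, x k)) atTop
        (𝓝 ((F - P F) ((2 / c) • f))) := by
      have h2 := (hF x hx _ hlim).sub (hlim y)
      rw [← hy]
      exact h2
    have h3 := le_of_tendsto h1.norm (Eventually.of_forall hbound)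
    rw [map_smul, ← hc, smul_eq_mul, div_mul_cancel₀ _ hne] at h3
    norm_num at h3
  exact ⟨y, hy.trans (sub_eq_zero.1 hsing).symm⟩

end LEmbedded

theorem mainTheorem2 {𝕜 : Type u} [RCLike 𝕜]
    (X : Type v) [NormedAddCommGroup X] [NormedSpace 𝕜 X] [CompleteSpace X]
    [TopologicalSpace.SeparableSpace X] (hX : IsLEmbedded 𝕜 X) :
    (∀ (Y : Type v') [NormedAddCommGroup Y] [NormedSpace 𝕜 Y] [CompleteSpace Y]
        (M : Submodule 𝕜 X), Nonempty (Y ≃L[𝕜] M) → IsUniquePredual.{u, v', w} 𝕜 Y) ∧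
      IsUniquePredual.{u, v, w} 𝕜 X := by
  refine ⟨fun Y _ _ _ M ⟨e⟩ => ?_, hX.hasPropertyX.isUniquePredual⟩
  exact (hX.hasPropertyX.of_equiv_submodule e).isUniquePredual
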